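/- **Setting.** Let $n,K\ge 2$. A causal model consists of a directed acyclic graph $D$ on variables $X_1,\dots,X_n$ with values in $[K]$, and, for each $i$, a conditional distribution $P(X_i=\cdot\mid \mathrm{Pa}(X_i)=z)$ for every value $z$ of the parents of $X_i$ in $D$. The observational distribution $P$ is the product of these conditional distributions. The intervention $\mathrm{do}(X_i=x)$ removes the edges into $X_i$ and fixes $X_i=x$, so that $P(\cdot\mid\mathrm{do}(X_i=x))$ is the correspondingly truncated product. A causal bandit instance $\nu$ is a causal model with a real reward $R$ and an index $r$ such that, given $X_1,\dots,X_n$, the law of $R$ depends only on the value of the reward generating variable $X_r$. The actions are the $nK$ single-node interventions $\mathcal A=\{\mathrm{do}(X_i=x): 1\le i\le n,\ x\in[K]\}$. The instance is Gaussian if for every $a\in\mathcal A$ the law of $R$ under $a$ is $N(\mu_a,1)$ with $\mu_a\in[0,1]$. The instance satisfies causal effect identifiability if there is $\varepsilon>0$ such that for every edge $X_i\to X_j$ of $D$ there are $x,x'\in[K]$ with $|P(X_j=x\mid\mathrm{do}(X_i=x'))-P(X_j=x)|>\varepsilon$. A (randomized) policy $\pi$ chooses $a_t$, for each round $t$, from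 a distribution depending measurably on the actions and observations of the rounds before $t$ (and not on $\nu$); then the values of $X_1,\dots,X_n$ and $R$ drawn under $a_t$ are observed. The regret over $T$ rounds is $R_T(\pi,\nu)=T\max_{a\in\mathcal A}\mu_a-\sum_{t=1}^T\mu_{a_t}$. **Theorem 4.** Let $\mathcal E_{n,K}$ be the class of all Gaussian causal bandit instances with $n$ variables with values in $[K]$ that do not satisfy causal effect identifiability, and let $\Pi$ be the set of all policies. There is an absolute constant $c>0$ such that for all $n\ge 2$, $K\ge 2$ and $T\ge nK$, $$\inf_{\pi\in\Pi}\ \sup_{\nu\in\mathcal E_{n,K}}\ \mathbb E[R_T(\pi,\nu)]\ \ge\ c\sqrt{nKT}.$$ -/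

import Mathlib

open MeasureTheory ProbabilityTheory
open scoped ENNReal

namespace CausalBandits

/-- A joint value `(x₁, …, xₙ)` of the variables `X₁, …, Xₙ`, each with domain `[K]`. -/
abbrev Config (n K : ℕ) : Type := Fin n → Fin K

/-- The action `do(Xᵢ = x)`, encoded as the pair `(i, x)`; there are `n * K` actions. -/
abbrev Action (n K : ℕ) : Type := Fin n × Fin K

/-- What the learner observes in one round: the values of all the variables and the reward. -/
abbrev Obs (n K : ℕ) : Type := Config n K × ℝ

/-- The record of one round: the action played and the resulting observation. -/
abbrev Round (n K : ℕ) : Type := Action n K × Obs n K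

/-- The record of the first `t` rounds. -/
abbrev History (n K t : ℕ) : Type := Fin t → Round n K

/-- A causal model: a directed acyclic graph on `n` variables with values in `[K]`, and for each
variable a conditional distribution given each value of its parents (also given those values of
the parents that have observational probability zero, since an intervention may produce them). -/
structure CausalModel (n K : ℕ) where
  graph : Digraph (Fin n)
  acyclic : ∀ i, ¬ Relation.TransGen graph.Adj i i
  cpd : (i : Fin n) → ({j : Fin n // graph.Adj j i} → Fin K) → PMF (Fin K)

namespace CausalModel

variable {n K : ℕ} (M : CausalModel n K)

/-- The distribution of `Xᵢ` given the values of the other variables, in the regime `a`: `none` is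
the empty intervention `do()`, and `some (j, v)` is `do(Xⱼ = v)`, which disconnects `Xⱼ` from its
parents and sets it to `v`. -/
noncomputable def factor (a : Option (Action n K)) (i : Fin n) (x : Config n K) : PMF (Fin K) :=
  match a with
  | none => M.cpd i (fun j => x j)
  | some (j, v) => if i = j then PMF.pure v else M.cpd i (fun j => x j)

/-- The (truncated) factorization of the joint distribution in the regime `a`. -/
noncomputable def weight (a : Option (Action n K)) (x : Config n K) : ℝ≥0∞ :=
  ∏ i, M.factor a i x (x i)

theorem factor_congr (a : Option (Action n K)) (i : Fin n) {x y : Config n K}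
    (h : ∀ j, M.graph.Adj j i → x j = y j) : M.factor a i x = M.factor a i y := by
  have : (fun j : {j : Fin n // M.graph.Adj j i} => x j.1) =
      fun j : {j : Fin n // M.graph.Adj j i} => y j.1 :=
    funext fun j => h j.1 j.2
  unfold factor
  rw [this]

theorem wellFounded : WellFounded M.graph.Adj := by
  have : Std.Irrefl (Relation.TransGen M.graph.Adj) := ⟨M.acyclic⟩
  have h : WellFounded (Relation.TransGen M.graph.Adj) :=
    Finite.wellFounded_of_trans_of_irrefl _
  exact Subrelation.wf (fun h => Relation.TransGen.single h) h

theorem nonempty_value (M : CausalModel n K) (i : Fin n) : Nonempty (Fin K) := by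
  induction i using M.wellFounded.induction with
  | _ i ih =>
    obtain ⟨v, -⟩ := (M.cpd i (fun j => (ih j j.2).some)).support_nonempty
    exact ⟨v⟩

theorem sum_sum_update (f : Config n K → ℝ≥0∞) (j : Fin n) :
    ∑ x : Config n K, ∑ v : Fin K, f (Function.update x j v) = K * ∑ x, f x := by
  classical
  rw [← Finset.sum_product']
  have e : ∑ p : Config n K × Fin K, f (Function.update p.1 j p.2)
      = ∑ p : Config n K × Fin K, f p.1 := by
    refine Finset.sum_bij' (fun p _ => (Function.update p.1 j p.2, p.1 j))
      (fun p _ => (Function.update p.1 j p.2, p.1 j)) ?_ ?_ ?_ ?_ ?_ <;> simp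
  rw [Finset.univ_product_univ, e, Fintype.sum_prod_type]
  simp [Finset.mul_sum]

theorem sum_weight_aux (a : Option (Action n K)) (m : ℕ) :
    ∀ S : Finset (Fin n), S.card = m → (∀ i ∈ S, ∀ j, M.graph.Adj j i → j ∈ S) →
      (K : ℝ≥0∞) ^ m * ∑ x : Config n K, ∏ i ∈ S, M.factor a i x (x i) = (K : ℝ≥0∞) ^ n := by
  classical
  induction m with
  | zero =>
    intro S hS _
    rw [Finset.card_eq_zero] at hS
    simp [hS]
  | succ m ih =>
    intro S hS hcl
    have hne : S.Nonempty := Finset.card_pos.mp (by omega)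
    have : Std.Irrefl (Function.swap (Relation.TransGen M.graph.Adj)) := ⟨M.acyclic⟩
    have : IsTrans (Fin n) (Function.swap (Relation.TransGen M.graph.Adj)) :=
      ⟨fun _ _ _ h₁ h₂ => Relation.TransGen.trans h₂ h₁⟩
    obtain ⟨j, hjS, hj⟩ := (Finite.wellFounded_of_trans_of_irrefl
      (Function.swap (Relation.TransGen M.graph.Adj))).has_min (S : Set (Fin n)) hne
    have hsink : ∀ i ∈ S, ¬ M.graph.Adj j i := fun i hi h =>
      hj i hi (Relation.TransGen.single h)
    have hjS' : j ∈ S := hjS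
    have key : ∀ x : Config n K, ∑ v : Fin K,
        ∏ i ∈ S, M.factor a i (Function.update x j v) (Function.update x j v i)
          = ∏ i ∈ S.erase j, M.factor a i x (x i) := by
      intro x
      have h1 : ∀ v : Fin K,
          ∏ i ∈ S, M.factor a i (Function.update x j v) (Function.update x j v i)
            = M.factor a j x v * ∏ i ∈ S.erase j, M.factor a i x (x i) := by
        intro v
        rw [← Finset.mul_prod_erase S _ hjS']
        have hf : ∀ i ∈ S, M.factor a i (Function.update x j v) = M.factor a i x := by
          intro i hi
          apply M.factor_congr
          intro l hl
          have : l ≠ j := fun h => hsink i hi (h ▸ hl)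
          simp [this]
        rw [hf j hjS']
        congr 1
        · simp
        · refine Finset.prod_congr rfl fun i hi => ?_
          rw [hf i (Finset.mem_of_mem_erase hi)]
          simp [Finset.ne_of_mem_erase hi]
      simp_rw [h1]
      rw [← Finset.sum_mul]
      have := (M.factor a j x).tsum_coe
      rw [tsum_fintype] at this
      rw [this, one_mul]
    have h2 := sum_sum_update
      (fun x : Config n K => ∏ i ∈ S, M.factor a i x (x i)) j
    simp_rw [key] at h2
    rw [pow_succ, mul_assoc, ← h2]
    refine ih (S.erase j) (by rw [Finset.card_erase_of_mem hjS']; omega) ?_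
    intro i hi l hl
    have hi' := Finset.mem_of_mem_erase hi
    exact Finset.mem_erase.mpr ⟨fun h => hsink i hi' (h ▸ hl), hcl i hi' l hl⟩

theorem sum_weight (a : Option (Action n K)) : ∑ x, M.weight a x = 1 := by
  have h := M.sum_weight_aux a n Finset.univ (by simp) (by simp)
  rcases Nat.eq_zero_or_pos n with rfl | hn
  · simp [weight]
  · have hK : K ≠ 0 := by
      rintro rfl
      exact (M.nonempty_value ⟨0, hn⟩).elim Fin.elim0
    have h0 : (K : ℝ≥0∞) ^ n ≠ 0 := pow_ne_zero _ (by exact_mod_cast hK)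
    have ht : (K : ℝ≥0∞) ^ n ≠ ∞ := ENNReal.pow_ne_top (ENNReal.natCast_ne_top K)
    rw [← ENNReal.mul_right_inj h0 ht, mul_one]
    exact h

/-- The joint distribution of `X₁, …, Xₙ` in the regime `a`: the observational distribution `P` for
`a = none`, and `P(· | do(Xⱼ = v))` for `a = some (j, v)`. -/
noncomputable def law (a : Option (Action n K)) : PMF (Config n K) :=
  PMF.ofFintype (M.weight a) (M.sum_weight a)

/-- The probability of `Xⱼ = x` in the regime `a`. -/
noncomputable def prob (a : Option (Action n K)) (j : Fin n) (x : Fin K) : ℝ :=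
  (M.law a).toMeasure.real {ω | ω j = x}

/-- Causal effect identifiability. -/
def CausalEffectIdentifiable : Prop :=
  ∃ ε : ℝ, 0 < ε ∧ ∀ i j, M.graph.Adj i j →
    ∃ x x' : Fin K, ε < |M.prob (some (i, x')) j x - M.prob none j x|

end CausalModel

/-- A causal bandit instance: a causal model with a reward that is directly influenced by exactly
one variable, the reward generating variable: given `X₁, …, Xₙ`, the reward has the law
`reward x`, where `x` is the value of the reward generating variable. -/
structure CausalBandit (n K : ℕ) extends CausalModel n K where
  rewardNode : Fin n
  reward : Kernel (Fin K) ℝ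
  isMarkovKernel_reward : IsMarkovKernel reward

namespace CausalBandit

variable {n K : ℕ} (ν : CausalBandit n K)

instance : IsMarkovKernel ν.reward := ν.isMarkovKernel_reward

/-- The joint law of the variables and the reward under the action `a`. -/
noncomputable def obsLaw (a : Action n K) : Measure (Obs n K) :=
  (ν.law (some a)).toMeasure ⊗ₘ
    (ν.reward.comap (fun x : Config n K => x ν.rewardNode) (measurable_pi_apply _))

instance (a : Action n K) : IsProbabilityMeasure (ν.obsLaw a) := by
  unfold obsLaw; infer_instance

/-- The law of the reward under the action `a`. -/
noncomputable def rewardLaw (a : Action n K) : Measure ℝ := (ν.obsLaw a).map Prod.snd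

/-- The expected reward `μ_a` of the action `a`. -/
noncomputable def mean (a : Action n K) : ℝ := ∫ r, r ∂(ν.rewardLaw a)

/-- The Gaussian causal bandits: under every action the reward is Gaussian, with unit variance and
with mean in `[0, 1]`. -/
def IsGaussian : Prop :=
  ∀ a : Action n K, ∃ m ∈ Set.Icc (0 : ℝ) 1, ν.rewardLaw a = gaussianReal m 1

/-- `obsLaw` as a kernel from actions to observations. -/
noncomputable def obsKernel : Kernel (Action n K) (Obs n K) :=
  Kernel.ofFunOfCountable ν.obsLaw

instance : IsMarkovKernel ν.obsKernel := ⟨fun a => by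
  change IsProbabilityMeasure (ν.obsLaw a); infer_instance⟩

end CausalBandit

/-- A (possibly randomized) policy: a distribution over the actions given the record of all the
earlier rounds. -/
structure Policy (n K : ℕ) where
  choose : (t : ℕ) → Kernel (History n K t) (Action n K)
  isMarkovKernel_choose : ∀ t, IsMarkovKernel (choose t)

instance {n K : ℕ} (π : Policy n K) (t : ℕ) : IsMarkovKernel (π.choose t) :=
  π.isMarkovKernel_choose t

section Interaction

variable {n K : ℕ} (ν : CausalBandit n K) (π : Policy n K)

/-- The law of the record of the round following the first `t` rounds, given these: the action is
drawn from the policy, and the observation from the law that the action induces. -/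
noncomputable def roundKernel (t : ℕ) : Kernel (History n K t) (Round n K) :=
  π.choose t ⊗ₖ Kernel.prodMkLeft (History n K t) ν.obsKernel

instance (t : ℕ) : IsMarkovKernel (roundKernel ν π t) := by
  unfold roundKernel; infer_instance

/-- Append the record of one more round to a history. -/
def History.snoc {t : ℕ} (p : History n K t × Round n K) : History n K (t + 1) :=
  Fin.snoc (α := fun _ => Round n K) p.1 p.2

theorem History.measurable_snoc {t : ℕ} :
    Measurable (History.snoc : History n K t × Round n K → History n K (t + 1)) := by
  refine measurable_pi_lambda _ fun i => ?_
  refine Fin.lastCases ?_ (fun i => ?_) i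
  · simpa [History.snoc] using measurable_snd
  · simp only [History.snoc, Fin.snoc_castSucc]
    exact (measurable_pi_apply i).comp measurable_fst

/-- The law of the record of the first `t` rounds when `π` plays against `ν`. -/
noncomputable def histLaw : (t : ℕ) → Measure (History n K t)
  | 0 => Measure.dirac Fin.elim0
  | t + 1 => (histLaw t ⊗ₘ roundKernel ν π t).map History.snoc

instance isProbabilityMeasure_histLaw (t : ℕ) : IsProbabilityMeasure (histLaw ν π t) := by
  induction t with
  | zero => unfold histLaw; infer_instance
  | succ t ih =>
    unfold histLaw
    exact Measure.isProbabilityMeasure_map History.measurable_snoc.aemeasurable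

/-- The expected cumulative regret `𝔼[T μ_{a*} - ∑ₜ μ_{aₜ}]` of `π` against `ν` over `T` rounds. -/
noncomputable def expectedRegret (T : ℕ) : ℝ :=
  ∫ h : History n K T, (T * (⨆ a, ν.mean a) - ∑ t, ν.mean (h t).1) ∂(histLaw ν π T)

end Interaction

/-- The `nK`-armed Gaussian causal bandits that violate causal effect identifiability. -/
def nonIdentifiableGaussian (n K : ℕ) : Set (CausalBandit n K) :=
  {ν | ν.IsGaussian ∧ ¬ ν.CausalEffectIdentifiable}

/-- The minimax expected regret over a class `E` of causal bandits, as an extended real. -/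
noncomputable def minimaxRegret {n K : ℕ} (E : Set (CausalBandit n K)) (T : ℕ) : EReal :=
  ⨅ π : Policy n K, ⨆ ν ∈ E, (expectedRegret ν π T : EReal)

end CausalBandits

/-! Without causal effect identifiability the graph may carry an edge with no effect. Take all
variables equal to 0 almost surely, with one such edge. Intervening on one variable then says
nothing about the others, and side observations are worthless. Choose a = do(Xᵢ = v) with v ≠ 0, let
Xᵢ generate the reward, and let the mean be Δ when Xᵢ = v and 0 otherwise. Only a ever produces Xᵢ =
v, so this is a Gaussian bandit with one good arm hidden among N = n(K - 1) candidates.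

Compare with the reference bandit Δ = 0. There some candidate a has at most T/N expected plays
(`exists_integral_playCount_le`). Planting the signal at a changes the law of the history only
through the rewards of the rounds that play a, and the relative entropy is Δ²/2 times the expected
number of plays in the reference (`integral_sum_logRatio`). For Δ of order √(N/T) this is bounded,
and an affine substitute for Pinsker's inequality (`integral_withDensity_exp_le`) shows that a is
still missed in a constant fraction of the rounds. Each miss costs Δ, so the regret is of order TΔ,
that is √(NT), which is comparable to √(nKT). -/

namespace CausalBandits

/-! ### Laws of histories under a change of bandit -/

section History

variable {n K : ℕ}

theorem CausalBandit.obsKernel_apply (ν : CausalBandit n K) (a : Action n K) :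
    ν.obsKernel a = ν.obsLaw a :=
  rfl

theorem lintegral_histLaw_succ (ν : CausalBandit n K) (π : Policy n K) (t : ℕ)
    {f : History n K (t + 1) → ℝ≥0∞} (hf : Measurable f) :
    ∫⁻ h, f h ∂(histLaw ν π (t + 1)) =
      ∫⁻ h, ∫⁻ a, ∫⁻ o, f (History.snoc (h, (a, o))) ∂(ν.obsLaw a) ∂(π.choose t h)
        ∂(histLaw ν π t) := by
  have hfs : Measurable fun p : History n K t × Round n K => f (History.snoc p) :=
    hf.comp History.measurable_snoc
  rw [histLaw, lintegral_map hf History.measurable_snoc, Measure.lintegral_compProd hfs]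
  refine lintegral_congr fun h => ?_
  rw [roundKernel, Kernel.lintegral_compProd _ _ _
    (show Measurable fun x : Round n K => f (History.snoc (h, x)) from
      hfs.comp measurable_prodMk_left)]
  rfl

/-- If the observations of `ν'` have likelihood ratio `ℓ` with respect to those of `ν`, then the
histories have as likelihood ratio the product of those of the rounds. -/
theorem lintegral_histLaw_of_density {ν ν' : CausalBandit n K} (π : Policy n K)
    {ℓ : Round n K → ℝ≥0∞} (hℓ : Measurable ℓ)
    (hν : ∀ a, ν'.obsLaw a = (ν.obsLaw a).withDensity fun o => ℓ (a, o)) (t : ℕ) :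
    ∀ f : History n K t → ℝ≥0∞, Measurable f →
      ∫⁻ h, f h ∂(histLaw ν' π t) = ∫⁻ h, (∏ s, ℓ (h s)) * f h ∂(histLaw ν π t) := by
  induction t with
  | zero =>
    intro f hf
    simp [histLaw]
  | succ t ih =>
    intro f hf
    have hprod : ∀ m, Measurable fun h : History n K m => ∏ s, ℓ (h s) := fun m =>
      Finset.measurable_prod _ fun s _ => hℓ.comp (measurable_pi_apply s)
    have hfs : Measurable fun p : History n K t × Round n K => f (History.snoc p) :=
      hf.comp History.measurable_snoc
    have hg : Measurable fun p : History n K t × Round n K => ℓ p.2 * f (History.snoc p) :=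
      (hℓ.comp measurable_snd).mul hfs
    have hmeas : Measurable fun h : History n K t => ∫⁻ a, ∫⁻ o,
        ℓ (a, o) * f (History.snoc (h, (a, o))) ∂(ν.obsLaw a) ∂(π.choose t h) := by
      have := hg.lintegral_kernel_prod_right' (κ := roundKernel ν π t)
      convert this using 2 with h
      rw [roundKernel, Kernel.lintegral_compProd _ _ _
        (show Measurable fun x : Round n K => ℓ x * f (History.snoc (h, x)) from
          hg.comp measurable_prodMk_left)]
      rfl
    rw [lintegral_histLaw_succ ν' π t hf, lintegral_histLaw_succ ν π t
      (show Measurable fun h => (∏ s, ℓ (h s)) * f h from (hprod _).mul hf)]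
    -- The policy enters both laws identically, so only the observation of the last round is
    -- reweighted here; the induction hypothesis reweights the earlier rounds.
    have h1 : ∀ (h : History n K t) (a : Action n K),
        ∫⁻ o, f (History.snoc (h, (a, o))) ∂(ν'.obsLaw a) =
          ∫⁻ o, ℓ (a, o) * f (History.snoc (h, (a, o))) ∂(ν.obsLaw a) := by
      intro h a
      rw [hν a, lintegral_withDensity_eq_lintegral_mul _
        (show Measurable fun o => ℓ (a, o) from hℓ.comp measurable_prodMk_left)
        (show Measurable fun o => f (History.snoc (h, (a, o))) from
          hfs.comp (measurable_prodMk_left.comp measurable_prodMk_left))]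
      rfl
    simp_rw [h1]
    rw [ih _ hmeas]
    refine lintegral_congr fun h => ?_
    have hin : ∀ a : Action n K, Measurable fun o : Obs n K =>
        ℓ (a, o) * f (History.snoc (h, (a, o))) := fun a =>
      hg.comp (measurable_prodMk_left.comp measurable_prodMk_left)
    rw [← lintegral_const_mul _ (measurable_of_countable _)]
    refine lintegral_congr fun a => ?_
    rw [← lintegral_const_mul _ (hin a)]
    refine lintegral_congr fun o => ?_
    simp [Fin.prod_univ_castSucc, History.snoc, mul_assoc]

/-- The law of a round: its action has some law, and given the action the observation has the law
that the action induces. -/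
theorem exists_map_histLaw_eq_compProd (ν : CausalBandit n K) (π : Policy n K) (t : ℕ) :
    ∀ s : Fin t, ∃ m : Measure (Action n K), IsProbabilityMeasure m ∧
      (histLaw ν π t).map (fun h => h s) = m ⊗ₘ ν.obsKernel := by
  induction t with
  | zero => exact fun s => s.elim0
  | succ t ih =>
    intro s
    have key : ∀ s : Fin (t + 1), ∀ f : Round n K → ℝ≥0∞, Measurable f →
        ∫⁻ x, f x ∂((histLaw ν π (t + 1)).map fun h => h s) =
          ∫⁻ h, ∫⁻ a, ∫⁻ o, f ((History.snoc (h, (a, o)) : History n K (t + 1)) s)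
            ∂(ν.obsLaw a) ∂(π.choose t h) ∂(histLaw ν π t) := by
      intro s f hf
      rw [lintegral_map hf (measurable_pi_apply s),
        lintegral_histLaw_succ ν π t (f := fun h => f (h s))
          (hf.comp (measurable_pi_apply s))]
    -- In the last round the action has the policy's distribution averaged over histories; an
    -- earlier round keeps its law when a round is appended.
    refine Fin.lastCases ?_ (fun s => ?_) s
    · refine ⟨(histLaw ν π t).bind (π.choose t), inferInstance,
        Measure.ext_of_lintegral _ fun f hf => ?_⟩
      rw [key _ f hf, Measure.lintegral_compProd hf,
        Measure.lintegral_bind (Kernel.aemeasurable _) (measurable_of_countable _).aemeasurable]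
      simp [History.snoc, CausalBandit.obsKernel_apply]
    · obtain ⟨m, hm, hs⟩ := ih s
      refine ⟨m, hm, Measure.ext_of_lintegral _ fun f hf => ?_⟩
      rw [key _ f hf, ← hs, lintegral_map hf (measurable_pi_apply s)]
      simp [History.snoc]

/-- A reward-dependent quantity that has mean zero under every action has mean zero in every
round. -/
theorem integral_round_eq_zero (ν : CausalBandit n K) (π : Policy n K) {φ : Round n K → ℝ}
    (hφ : Measurable φ) (hint : ∀ a, Integrable (fun o => φ (a, o)) (ν.obsLaw a))
    (hzero : ∀ a, ∫ o, φ (a, o) ∂(ν.obsLaw a) = 0) (t : ℕ) (s : Fin t) :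
    Integrable (fun h => φ (h s)) (histLaw ν π t) ∧ ∫ h, φ (h s) ∂(histLaw ν π t) = 0 := by
  obtain ⟨m, hm, hs⟩ := exists_map_histLaw_eq_compProd ν π t s
  have hi : Integrable φ ((histLaw ν π t).map fun h => h s) := by
    rw [hs, Measure.integrable_compProd_iff hφ.aestronglyMeasurable]
    -- Integrability of the norms over actions is automatic because there are finitely many actions.
    exact ⟨ae_of_all _ fun a => hint a, Integrable.of_finite⟩
  refine ⟨hi.comp_measurable (measurable_pi_apply s), ?_⟩
  rw [← integral_map (measurable_pi_apply s).aemeasurable hφ.aestronglyMeasurable, hs,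
    Measure.integral_compProd (hs ▸ hi)]
  simp [CausalBandit.obsKernel_apply, hzero]

end History

/-! ### Change of measure through relative entropy -/

/-- A change of measure inequality: the expectation of a function with values in `[0, 1]` under the
measure with log-likelihood ratio `g` exceeds the one under `μ` by at most an affine function of the
relative entropy `-∫ g ∂μ`. -/
theorem integral_withDensity_exp_le {Ω : Type*} [MeasurableSpace Ω] {μ ν : Measure Ω}
    [IsProbabilityMeasure μ] [IsProbabilityMeasure ν] {g : Ω → ℝ} (hg : Measurable g)
    (hgi : Integrable g μ) (hν : ν = μ.withDensity fun x => ENNReal.ofReal (Real.exp (g x)))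
    {f : Ω → ℝ} (hf : Measurable f) (hf0 : ∀ x, 0 ≤ f x) (hf1 : ∀ x, f x ≤ 1) :
    ∫ x, f x ∂ν ≤ ∫ x, f x ∂μ - 4 * ∫ x, g x ∂μ + 1 / 4 := by
  have hexp : Measurable fun x => Real.exp (g x) := hg.exp
  have hL : ∫⁻ x, ENNReal.ofReal (Real.exp (g x)) ∂μ = 1 := by
    have h : ν Set.univ = 1 := measure_univ
    rwa [hν, withDensity_apply _ MeasurableSet.univ, Measure.restrict_univ] at h
  have hei : Integrable (fun x => Real.exp (g x)) μ :=
    ⟨hexp.aestronglyMeasurable, by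
      rw [hasFiniteIntegral_iff_ofReal (ae_of_all _ fun x => (Real.exp_pos _).le), hL]
      exact ENNReal.one_lt_top⟩
  have he1 : ∫ x, Real.exp (g x) ∂μ = 1 := by
    rw [integral_eq_lintegral_of_nonneg_ae (ae_of_all _ fun x => (Real.exp_pos _).le)
      hexp.aestronglyMeasurable, hL, ENNReal.toReal_one]
  have hfi : Integrable f μ := Integrable.of_bound hf.aestronglyMeasurable 1
    (ae_of_all _ fun x => by rw [Real.norm_of_nonneg (hf0 x)]; exact hf1 x)
  have h1 : ∫ x, f x ∂ν = ∫ x, Real.exp (g x) * f x ∂μ := by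
    rw [hν, integral_withDensity_eq_integral_toReal_smul hexp.ennreal_ofReal
      (ae_of_all _ fun _ => ENNReal.ofReal_lt_top)]
    simp [ENNReal.toReal_ofReal (Real.exp_pos _).le]
  -- Since `exp g` has integral 1, integrating this bound turns the second term into -4 ∫ g and the
  -- last into 1/4. With u = exp (g/2), the inequality g/2 ≤ u - 1 gives exp g - 1 - g ≥ (u - 1)².
  have hpt : ∀ x, Real.exp (g x) * f x ≤
      f x + 4 * (Real.exp (g x) - 1 - g x) + (Real.exp (g x) + 1) / 8 := by
    intro x
    have hs : Real.exp (g x) = Real.exp (g x / 2) ^ 2 := by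
      rw [← Real.exp_nat_mul]; congr 1; push_cast; ring
    have hl := Real.add_one_le_exp (g x / 2)
    have hp := Real.exp_pos (g x / 2)
    rw [hs]
    generalize Real.exp (g x / 2) = u at *
    have h0 := hf0 x
    have h1 := hf1 x
    -- For u ≥ 1 use f ≤ 1 and AM-GM for the factors 2(u - 1) and (u + 1)/4; for u ≤ 1 the left side
    -- is nonpositive.
    have h2 : (u ^ 2 - 1) * f x ≤ 4 * (u - 1) ^ 2 + (u + 1) ^ 2 / 16 := by
      rcases le_total 1 u with hu | hu
      · nlinarith [sq_nonneg (2 * (u - 1) - (u + 1) / 4), mul_nonneg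
          (mul_nonneg (sub_nonneg.mpr hu) (by linarith : 0 ≤ u + 1)) (sub_nonneg.mpr h1)]
      · nlinarith [sq_nonneg (u - 1), sq_nonneg (u + 1), mul_nonneg
          (mul_nonneg (sub_nonneg.mpr hu) (by linarith : 0 ≤ u + 1)) h0]
    nlinarith [sq_nonneg (u - 1)]
  have hi1 : Integrable (fun x => Real.exp (g x) - 1) μ := hei.sub (integrable_const _)
  have hi2 : Integrable (fun x => Real.exp (g x) - 1 - g x) μ := hi1.sub hgi
  have hi3 : Integrable (fun x => Real.exp (g x) + 1) μ := hei.add (integrable_const _)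
  have hi4 : Integrable (fun x => f x + 4 * (Real.exp (g x) - 1 - g x)) μ :=
    hfi.add (hi2.const_mul 4)
  have hi5 : Integrable
      (fun x => f x + 4 * (Real.exp (g x) - 1 - g x) + (Real.exp (g x) + 1) / 8) μ :=
    hi4.add (hi3.div_const 8)
  have h2 := integral_mono_of_nonneg
    (ae_of_all μ fun x => mul_nonneg (Real.exp_pos (g x)).le (hf0 x)) hi5 (ae_of_all _ hpt)
  rw [h1]
  refine h2.trans (le_of_eq ?_)
  rw [integral_add hi4 (hi3.div_const 8), integral_add hfi (hi2.const_mul 4), integral_const_mul,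
    integral_sub hi1 hgi, integral_sub hei (integrable_const _), integral_div,
    integral_add hei (integrable_const _), he1]
  simp
  ring

/-! ### The hard instances -/

section Planted

variable {n K : ℕ}

/-- A causal model in which every variable vanishes almost surely whatever its parents, with the
ineffective edge `X₁ → X₂` as the only edge. -/
noncomputable def constantModel (n K : ℕ) [NeZero K] : CausalModel n K where
  graph := ⟨fun i j => i.val = 0 ∧ j.val = 1⟩
  acyclic i h := by
    have hlt : ∀ {a b : Fin n},
        Relation.TransGen (fun i j : Fin n => i.val = 0 ∧ j.val = 1) a b → a < b := by
      intro a b h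
      induction h with
      | single h => exact Fin.lt_def.mpr (by omega)
      | tail _ h ih => exact ih.trans (Fin.lt_def.mpr (by omega))
    exact lt_irrefl i (hlt h)
  cpd _ _ := PMF.pure 0

/-- The values of the variables of `constantModel` in a regime. -/
def constantValue (n K : ℕ) [NeZero K] : Option (Action n K) → Config n K
  | none => fun _ => 0
  | some a => Function.update (fun _ => 0) a.1 a.2

theorem constantModel_law [NeZero K] (a : Option (Action n K)) :
    (constantModel n K).law a = PMF.pure (constantValue n K a) := by
  have hfac : ∀ i x, (constantModel n K).factor a i x = PMF.pure (constantValue n K a i) := by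
    intro i x
    rcases a with _ | ⟨j, v⟩
    · rfl
    · by_cases h : i = j
      · subst h; simp [CausalModel.factor, constantValue]
      · simp [CausalModel.factor, constantValue, h, constantModel]
  refine PMF.ext fun x => ?_
  rw [CausalModel.law, PMF.ofFintype_apply, CausalModel.weight]
  simp_rw [hfac, PMF.pure_apply]
  by_cases h : x = constantValue n K a
  · simp [h]
  · obtain ⟨i, hi⟩ := Function.ne_iff.mp h
    rw [if_neg h]
    exact Finset.prod_eq_zero (Finset.mem_univ i) (if_neg hi)

/-- Setting the first variable leaves the second at 0, so the single edge has effect exactly 0 and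
no ε > 0 works. -/
theorem constantModel_not_identifiable [NeZero K] (hn : 2 ≤ n) :
    ¬ (constantModel n K).CausalEffectIdentifiable := by
  rintro ⟨ε, hε, h⟩
  obtain ⟨x, x', hx⟩ := h ⟨0, by omega⟩ ⟨1, by omega⟩ ⟨rfl, rfl⟩
  have hp : ∀ a, (constantModel n K).prob a ⟨1, by omega⟩ x =
      (Measure.dirac (constantValue n K a)).real {ω | ω ⟨1, by omega⟩ = x} := fun a => by
    rw [CausalModel.prob, constantModel_law, PMF.toMeasure_pure]
  have hv : constantValue n K (some (⟨0, by omega⟩, x')) ⟨1, by omega⟩ =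
      constantValue n K none ⟨1, by omega⟩ := by
    simp [constantValue, Function.update_of_ne]
  simp only [hp, measureReal_def, Measure.dirac_apply, Set.indicator, Set.mem_ofPred_eq, hv,
    Pi.one_apply, sub_self, abs_zero] at hx
  exact hx.not_gt hε

/-- The bandit over `constantModel` with reward generating variable `a.1`, whose mean reward is `Δ`
if this variable has the value `a.2` and `0` otherwise. -/
noncomputable def planted [NeZero K] (a : Action n K) (Δ : ℝ) : CausalBandit n K where
  toCausalModel := constantModel n K
  rewardNode := a.1
  reward := Kernel.ofFunOfCountable fun w => gaussianReal (if w = a.2 then Δ else 0) 1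
  isMarkovKernel_reward := ⟨fun w => by
    change IsProbabilityMeasure (gaussianReal _ _); infer_instance⟩

/-- Every intervention on another variable leaves the reward generating variable at 0. As `a.2 ≠ 0`,
only `a` itself triggers the signal. -/
theorem planted_obsLaw [NeZero K] {a : Action n K} (ha : a.2 ≠ 0) (Δ : ℝ) (b : Action n K) :
    (planted a Δ).obsLaw b = (gaussianReal (if b = a then Δ else 0) 1).map
      (Prod.mk (constantValue n K (some b))) := by
  have hval : constantValue n K (some b) a.1 = a.2 ↔ b = a := by
    rcases eq_or_ne a.1 b.1 with h | h
    · simp [constantValue, h, Prod.ext_iff]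
    · simp [constantValue, Function.update_of_ne h, ha.symm, Prod.ext_iff, h.symm]
  refine Measure.ext_of_lintegral _ fun f hf => ?_
  have hlaw : (planted a Δ).law (some b) = PMF.pure (constantValue n K (some b)) :=
    constantModel_law _
  rw [CausalBandit.obsLaw, Measure.lintegral_compProd hf, hlaw, PMF.toMeasure_pure,
    lintegral_dirac, lintegral_map hf measurable_prodMk_left]
  simp only [Kernel.comap_apply]
  change ∫⁻ r, _ ∂(gaussianReal (if constantValue n K (some b) a.1 = a.2 then Δ else 0) 1) = _
  simp only [hval]

/-- Without a signal the location of `a` is invisible, so any action, even one with value 0, indexes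
the reference bandit. -/
theorem planted_zero_obsLaw [NeZero K] (a b : Action n K) :
    (planted a 0).obsLaw b = (gaussianReal 0 1).map (Prod.mk (constantValue n K (some b))) := by
  refine Measure.ext_of_lintegral _ fun f hf => ?_
  have hlaw : (planted a 0).law (some b) = PMF.pure (constantValue n K (some b)) :=
    constantModel_law _
  rw [CausalBandit.obsLaw, Measure.lintegral_compProd hf, hlaw, PMF.toMeasure_pure,
    lintegral_dirac, lintegral_map hf measurable_prodMk_left]
  simp only [Kernel.comap_apply]
  change ∫⁻ r, _ ∂(gaussianReal (if constantValue n K (some b) a.1 = a.2 then 0 else 0) 1) = _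
  rw [ite_self]

theorem planted_rewardLaw [NeZero K] {a : Action n K} (ha : a.2 ≠ 0) (Δ : ℝ) (b : Action n K) :
    (planted a Δ).rewardLaw b = gaussianReal (if b = a then Δ else 0) 1 := by
  rw [CausalBandit.rewardLaw, planted_obsLaw ha, Measure.map_map measurable_snd
    measurable_prodMk_left]
  exact Measure.map_id

theorem planted_mean [NeZero K] {a : Action n K} (ha : a.2 ≠ 0) (Δ : ℝ) (b : Action n K) :
    (planted a Δ).mean b = if b = a then Δ else 0 := by
  rw [CausalBandit.mean, planted_rewardLaw ha, integral_id_gaussianReal]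

theorem planted_iSup_mean [NeZero K] {a : Action n K} (ha : a.2 ≠ 0) {Δ : ℝ} (hΔ : 0 ≤ Δ) :
    ⨆ b, (planted a Δ).mean b = Δ := by
  simp_rw [planted_mean ha]
  have : Nonempty (Action n K) := ⟨a⟩
  refine le_antisymm (ciSup_le fun b => ?_) ?_
  · split_ifs <;> simp [hΔ]
  · exact (if_pos rfl).symm.le.trans (le_ciSup (Set.finite_range
      fun b : Action n K => if b = a then Δ else 0).bddAbove a)

theorem planted_mem [NeZero K] (hn : 2 ≤ n) {a : Action n K} (ha : a.2 ≠ 0) {Δ : ℝ} (h0 : 0 ≤ Δ)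
    (h1 : Δ ≤ 1) : planted a Δ ∈ nonIdentifiableGaussian n K := by
  refine ⟨fun b => ⟨if b = a then Δ else 0, ?_, planted_rewardLaw ha Δ b⟩,
    constantModel_not_identifiable hn⟩
  split_ifs <;> simp [h0, h1]

/-- The log-likelihood ratio of a round between `planted a Δ` and the bandit without signal. -/
noncomputable def logRatio (a : Action n K) (Δ : ℝ) (x : Round n K) : ℝ :=
  if x.1 = a then Δ * x.2.2 - Δ ^ 2 / 2 else 0

theorem measurable_logRatio (a : Action n K) (Δ : ℝ) : Measurable (logRatio a Δ) :=
  Measurable.ite (measurable_fst (measurableSet_singleton a)) (by fun_prop) measurable_const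

theorem gaussianReal_eq_withDensity (Δ : ℝ) :
    gaussianReal Δ 1 = (gaussianReal 0 1).withDensity
      fun r => ENNReal.ofReal (Real.exp (Δ * r - Δ ^ 2 / 2)) := by
  rw [gaussianReal_of_var_ne_zero _ one_ne_zero, gaussianReal_of_var_ne_zero _ one_ne_zero,
    ← withDensity_mul _ (measurable_gaussianPDF _ _) (by fun_prop)]
  congr 1
  funext r
  simp only [Pi.mul_apply, gaussianPDF]
  rw [← ENNReal.ofReal_mul (gaussianPDFReal_nonneg _ _ _), gaussianPDFReal, gaussianPDFReal,
    mul_assoc (√_)⁻¹, ← Real.exp_add]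
  congr 3
  push_cast
  ring

theorem planted_obsLaw_eq_withDensity [NeZero K] (a₀ : Action n K) {a : Action n K} (ha : a.2 ≠ 0)
    (Δ : ℝ) (b : Action n K) :
    (planted a Δ).obsLaw b = ((planted a₀ 0).obsLaw b).withDensity
      fun o => ENNReal.ofReal (Real.exp (logRatio a Δ (b, o))) := by
  refine Measure.ext_of_lintegral _ fun f hf => ?_
  have hm : Measurable fun o : Obs n K => ENNReal.ofReal (Real.exp (logRatio a Δ (b, o))) :=
    ((measurable_logRatio a Δ).comp measurable_prodMk_left).exp.ennreal_ofReal
  rw [lintegral_withDensity_eq_lintegral_mul _ hm hf, planted_obsLaw ha, planted_zero_obsLaw,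
    lintegral_map hf measurable_prodMk_left, lintegral_map (hm.mul hf) measurable_prodMk_left]
  by_cases h : b = a
  · rw [if_pos h, gaussianReal_eq_withDensity, lintegral_withDensity_eq_lintegral_mul _
      (by fun_prop) (show Measurable fun r => f (constantValue n K (some b), r) from
        hf.comp measurable_prodMk_left)]
    simp [logRatio, h]
  · simp [logRatio, h]

end Planted

/-! ### Play counts and the regret bound -/

section LowerBound

variable {n K : ℕ}

/-- The number of rounds of a history in which the action `a` is played. -/
noncomputable def playCount {t : ℕ} (a : Action n K) (h : History n K t) : ℝ :=
  ∑ s, if (h s).1 = a then 1 else 0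

theorem measurable_playCount {t : ℕ} (a : Action n K) :
    Measurable (playCount a : History n K t → ℝ) :=
  Finset.measurable_sum _ fun s _ => Measurable.ite
    ((measurable_fst.comp (measurable_pi_apply s)) (measurableSet_singleton a))
    measurable_const measurable_const

theorem playCount_nonneg {t : ℕ} (a : Action n K) (h : History n K t) : 0 ≤ playCount a h :=
  Finset.sum_nonneg fun s _ => by split_ifs <;> norm_num

theorem sum_playCount_le {t : ℕ} (A : Finset (Action n K)) (h : History n K t) :
    ∑ a ∈ A, playCount a h ≤ t := by
  simp only [playCount]
  rw [Finset.sum_comm]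
  calc _ ≤ ∑ _s : Fin t, (1 : ℝ) := Finset.sum_le_sum fun s _ => by
        rw [Finset.sum_ite_eq]; split_ifs <;> norm_num
    _ = t := by simp

theorem playCount_le {t : ℕ} (a : Action n K) (h : History n K t) : playCount a h ≤ t := by
  simpa using sum_playCount_le {a} h

theorem integrable_playCount {t : ℕ} (a : Action n K) (μ : Measure (History n K t))
    [IsFiniteMeasure μ] : Integrable (playCount a) μ :=
  Integrable.of_bound (measurable_playCount a).aestronglyMeasurable t
    (ae_of_all _ fun h => by
      rw [Real.norm_of_nonneg (playCount_nonneg a h)]; exact playCount_le a h)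

variable [NeZero K]

/-- The log-likelihood ratio of a history has expectation minus the relative entropy, which the
divergence decomposition expresses by the expected number of plays. -/
theorem integral_sum_logRatio (a₀ a : Action n K) (Δ : ℝ) (π : Policy n K) (t : ℕ) :
    Integrable (fun h => ∑ s, logRatio a Δ (h s)) (histLaw (planted a₀ 0) π t) ∧
      ∫ h, ∑ s, logRatio a Δ (h s) ∂(histLaw (planted a₀ 0) π t) =
        -(Δ ^ 2 / 2) * ∫ h, playCount a h ∂(histLaw (planted a₀ 0) π t) := by
  -- The random part of the log-likelihood ratio is Δ times this reward, which is centred under the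
  -- reference bandit; what remains in expectation is the drift -Δ²/2 per play of `a`.
  let φ : Round n K → ℝ := fun x => if x.1 = a then x.2.2 else 0
  have hφ : Measurable φ := Measurable.ite (measurable_fst (measurableSet_singleton a))
    (by fun_prop) measurable_const
  have hφb : ∀ b, Measurable fun o : Obs n K => φ (b, o) := fun b =>
    hφ.comp measurable_prodMk_left
  have hφi : ∀ b, Integrable (fun o => φ (b, o)) ((planted a₀ 0).obsLaw b) := by
    intro b
    rw [planted_zero_obsLaw, integrable_map_measure (hφb b).aestronglyMeasurable
      measurable_prodMk_left.aemeasurable]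
    by_cases h : b = a
    · simp only [φ, h, if_true]
      exact IsGaussian.integrable_id
    · simp only [φ, h, if_false]
      exact integrable_const _
  have hφ0 : ∀ b, ∫ o, φ (b, o) ∂((planted a₀ 0).obsLaw b) = 0 := by
    intro b
    rw [planted_zero_obsLaw, integral_map measurable_prodMk_left.aemeasurable
      (hφb b).aestronglyMeasurable]
    by_cases h : b = a
    · simp [φ, h]
    · simp [φ, h]
  have hround := integral_round_eq_zero (planted a₀ 0) π hφ hφi hφ0 t
  have hsum : ∀ h : History n K t, ∑ s, logRatio a Δ (h s) =
      Δ * ∑ s, φ (h s) - Δ ^ 2 / 2 * playCount a h := by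
    intro h
    rw [playCount, Finset.mul_sum, Finset.mul_sum, ← Finset.sum_sub_distrib]
    refine Finset.sum_congr rfl fun s _ => ?_
    by_cases h' : (h s).1 = a <;> simp [logRatio, φ, h']
  have hi1 : Integrable (fun h : History n K t => Δ * ∑ s, φ (h s))
      (histLaw (planted a₀ 0) π t) :=
    (integrable_finsetSum _ fun s _ => (hround s).1).const_mul Δ
  have hi2 : Integrable (fun h : History n K t => Δ ^ 2 / 2 * playCount a h)
      (histLaw (planted a₀ 0) π t) := (integrable_playCount a _).const_mul _
  simp_rw [hsum]
  refine ⟨hi1.sub hi2, ?_⟩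
  rw [integral_sub hi1 hi2, integral_const_mul, integral_const_mul,
    integral_finsetSum _ fun s _ => (hround s).1, Finset.sum_eq_zero fun s _ => (hround s).2]
  ring

theorem histLaw_planted_eq_withDensity (a₀ : Action n K) {a : Action n K} (ha : a.2 ≠ 0) (Δ : ℝ)
    (π : Policy n K) (t : ℕ) :
    histLaw (planted a Δ) π t = (histLaw (planted a₀ 0) π t).withDensity
      fun h => ENNReal.ofReal (Real.exp (∑ s, logRatio a Δ (h s))) := by
  refine Measure.ext_of_lintegral _ fun f hf => ?_
  have hm : Measurable fun h : History n K t =>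
      ENNReal.ofReal (Real.exp (∑ s, logRatio a Δ (h s))) :=
    (Finset.measurable_sum _ fun s _ =>
      (measurable_logRatio a Δ).comp (measurable_pi_apply s)).exp.ennreal_ofReal
  rw [lintegral_withDensity_eq_lintegral_mul _ hm hf, lintegral_histLaw_of_density π
    (ℓ := fun x => ENNReal.ofReal (Real.exp (logRatio a Δ x)))
    (measurable_logRatio a Δ).exp.ennreal_ofReal (planted_obsLaw_eq_withDensity a₀ ha Δ) t f hf]
  refine lintegral_congr fun h => ?_
  rw [Pi.mul_apply, Real.exp_sum, ENNReal.ofReal_prod_of_nonneg fun s _ => (Real.exp_pos _).le]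

/-- The change of measure inequality is applied to the fraction of rounds playing `a`, which lies in
[0, 1]. The entropy term 4 · Δ²/2 · 𝔼[plays] is multiplied by T when the fraction is turned back
into a count. -/
theorem integral_playCount_planted_le (a₀ : Action n K) {a : Action n K} (ha : a.2 ≠ 0) (Δ : ℝ)
    (π : Policy n K) {T : ℕ} (hT : 0 < T) :
    ∫ h, playCount a h ∂(histLaw (planted a Δ) π T) ≤
      (1 + 2 * T * Δ ^ 2) * ∫ h, playCount a h ∂(histLaw (planted a₀ 0) π T) + T / 4 := by
  have hT' : (0 : ℝ) < T := by exact_mod_cast hT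
  obtain ⟨hi, hint⟩ := integral_sum_logRatio a₀ a Δ π T
  have hkey := integral_withDensity_exp_le
    (show Measurable fun h : History n K T => ∑ s, logRatio a Δ (h s) from
      Finset.measurable_sum _ fun s _ =>
        (measurable_logRatio a Δ).comp (measurable_pi_apply s)) hi
    (histLaw_planted_eq_withDensity a₀ ha Δ π T)
    ((measurable_playCount a).div_const (T : ℝ))
    (fun h => div_nonneg (playCount_nonneg a h) hT'.le)
    (fun h => (div_le_one hT').mpr (playCount_le a h))
  rw [hint, integral_div, integral_div] at hkey
  have := mul_le_mul_of_nonneg_left hkey hT'.le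
  rw [mul_div_cancel₀ _ hT'.ne'] at this
  refine this.trans (le_of_eq ?_)
  field_simp
  ring

theorem expectedRegret_planted {a : Action n K} (ha : a.2 ≠ 0) {Δ : ℝ} (hΔ : 0 ≤ Δ)
    (π : Policy n K) (T : ℕ) :
    expectedRegret (planted a Δ) π T =
      T * Δ - Δ * ∫ h, playCount a h ∂(histLaw (planted a Δ) π T) := by
  have hr : ∀ h : History n K T, T * (⨆ b, (planted a Δ).mean b) - ∑ t, (planted a Δ).mean (h t).1
      = T * Δ - Δ * playCount a h := by
    intro h
    rw [planted_iSup_mean ha hΔ, playCount, Finset.mul_sum]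
    simp [planted_mean ha]
  rw [expectedRegret]
  simp_rw [hr]
  rw [integral_sub (integrable_const _) ((integrable_playCount a _).const_mul Δ),
    integral_const, integral_const_mul, probReal_univ, one_smul]

/-- Some action with a nonzero value is played rarely in the absence of a signal. -/
theorem exists_integral_playCount_le (a₀ : Action n K) (hn : 0 < n) (hK : 2 ≤ K)
    (π : Policy n K) (T : ℕ) :
    ∃ a : Action n K, a.2 ≠ 0 ∧
      ∫ h, playCount a h ∂(histLaw (planted a₀ 0) π T) ≤ T / ((n : ℝ) * (K - 1)) := by
  -- Only these actions can carry a planted signal. Their play counts sum to at most T, so one of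
  -- them is at most the average.
  let A : Finset (Action n K) := Finset.univ ×ˢ Finset.univ.erase 0
  have hcard : (A.card : ℝ) = n * (K - 1) := by
    simp [A, Finset.card_erase_of_mem, Nat.cast_sub (show 1 ≤ K by omega)]
  have hpos : (0 : ℝ) < A.card := by
    have h1 : (2 : ℝ) ≤ K := by exact_mod_cast hK
    have h2 : (0 : ℝ) < n := by exact_mod_cast hn
    rw [hcard]
    exact mul_pos h2 (by linarith)
  have hsum : ∑ a ∈ A, ∫ h, playCount a h ∂(histLaw (planted a₀ 0) π T) ≤
      ∑ _a ∈ A, (T : ℝ) / A.card := by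
    rw [← integral_finsetSum _ fun a _ => integrable_playCount a _, Finset.sum_const, nsmul_eq_mul,
      mul_div_cancel₀ _ hpos.ne']
    refine (integral_mono (integrable_finsetSum _ fun a _ => integrable_playCount a _)
      (integrable_const (T : ℝ)) fun h => sum_playCount_le A h).trans (le_of_eq ?_)
    simp
  obtain ⟨a, ha, hle⟩ := Finset.exists_le_of_sum_le
    (Finset.card_pos.mp (by exact_mod_cast hpos)) hsum
  refine ⟨a, ?_, hcard ▸ hle⟩
  simpa [A] using ha

theorem exists_le_expectedRegret (hn : 2 ≤ n) (hK : 2 ≤ K) {T : ℕ} (hT : n * K ≤ T)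
    (π : Policy n K) :
    ∃ ν ∈ nonIdentifiableGaussian n K,
      1 / 64 * √((n : ℝ) * K * T) ≤ expectedRegret ν π T := by
  have a₀ : Action n K := (⟨0, by omega⟩, 0)
  obtain ⟨a, ha, hle⟩ := exists_integral_playCount_le a₀ (by omega) hK π T
  have hn' : (2 : ℝ) ≤ n := by exact_mod_cast hn
  have hK' : (2 : ℝ) ≤ K := by exact_mod_cast hK
  have hT' : (n : ℝ) * K ≤ T := by exact_mod_cast hT
  have hT0 : (0 : ℝ) < T := by nlinarith
  obtain ⟨N, hN⟩ : ∃ N : ℝ, N = n * (K - 1) := ⟨_, rfl⟩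
  rw [← hN] at hle
  have hN2 : 2 ≤ N := by nlinarith
  have hNT : N ≤ T := by nlinarith
  have hNK : (n : ℝ) * K ≤ 4 * N := by nlinarith
  have hNT0 : 0 ≤ N * T := by positivity
  -- This is √(N/T)/4, chosen so that 2TΔ² = N/8; N ≤ T keeps it at most 1.
  let Δ : ℝ := √(N * T) / (4 * T)
  have hΔ0 : 0 ≤ Δ := by positivity
  have hsqrt : √(N * T) ≤ T := Real.sqrt_le_iff.mpr ⟨hT0.le, by nlinarith⟩
  have hΔ1 : Δ ≤ 1 := (div_le_one (by positivity)).mpr (by linarith)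
  have hΔ2 : 2 * T * Δ ^ 2 = N / 8 := by
    simp only [Δ]
    rw [div_pow, Real.sq_sqrt hNT0]
    field_simp
    ring
  have hTΔ : T * Δ = √(N * T) / 4 := by
    simp only [Δ]
    field_simp
  refine ⟨planted a Δ, planted_mem hn ha hΔ0 hΔ1, ?_⟩
  have hcount := integral_playCount_planted_le a₀ ha Δ π (T := T) (by exact_mod_cast hT0)
  rw [hΔ2] at hcount
  -- T/N + T/8 with N ≥ 2. Adding the T/4 from the change of measure leaves at least T/8 expected
  -- rounds without `a`, hence regret at least TΔ/8 = √(NT)/32.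
  have h1 : (1 + N / 8) * (T / N) ≤ 5 / 8 * T := by
    have : (1 + N / 8) * (T / N) = T / N + T / 8 := by field_simp
    rw [this]
    have : (T : ℝ) / N ≤ T / 2 := div_le_div_of_nonneg_left hT0.le two_pos hN2
    linarith
  have h2 := mul_le_mul_of_nonneg_left hle (by positivity : 0 ≤ 1 + N / 8)
  have h3 : ∫ h, playCount a h ∂(histLaw (planted a Δ) π T) ≤ 7 / 8 * T := by linarith
  have h4 := mul_le_mul_of_nonneg_left h3 hΔ0
  -- Passing from N to nK costs this factor 2, whence 1/64.
  have h5 : √((n : ℝ) * K * T) ≤ 2 * √(N * T) := by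
    refine Real.sqrt_le_iff.mpr ⟨by positivity, ?_⟩
    rw [mul_pow, Real.sq_sqrt hNT0]
    nlinarith
  rw [expectedRegret_planted ha hΔ0]
  linarith

end LowerBound

end CausalBandits

theorem theorem4 :
    ∃ c : ℝ, 0 < c ∧ ∀ n K T : ℕ, 2 ≤ n → 2 ≤ K → n * K ≤ T →
      ((c * Real.sqrt ((n : ℝ) * K * T) : ℝ) : EReal) ≤
        CausalBandits.minimaxRegret (CausalBandits.nonIdentifiableGaussian n K) T := by
  refine ⟨1 / 64, by norm_num, fun n K T hn hK hT => le_iInf fun π => ?_⟩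
  have : NeZero K := ⟨by omega⟩
  obtain ⟨ν, hν, hle⟩ := CausalBandits.exists_le_expectedRegret hn hK hT π
  exact (EReal.coe_le_coe_iff.mpr hle).trans
    (le_iSup₂ (f := fun ν _ => (CausalBandits.expectedRegret ν π T : EReal)) ν hν)
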